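/- **Theorem (Nivat decomposition for weighted Büchi automata).** *Conventions.* An alphabet is a finite non-empty set; $X^\omega$ is the set of sequences $(x_i)_{i\in\mathbb N}$ in $X$, and an $\omega$-language over $X$ is a subset of $X^\omega$. A Büchi automaton $(Q,I,T,F)$ over an alphabet $\Sigma$ has a finite set $Q$ of states, $I,F\subseteq Q$ and $T\subseteq Q\times\Sigma\times Q$. A run is a sequence $\rho=(t_i)_{i\in\mathbb N}\in T^\omega$ with $t_i=(q_i,a_i,q_{i+1})$ for all $i$, $q_0\in I$, and some $q\in F$ with $q=q_i$ for infinitely many $i$; its label is $(a_i)_{i\in\mathbb N}$. An $\omega$-language $\mathcal L\subseteq\Sigma^\omega$ is recognizable if, for some Büchi automaton over $\Sigma$, it is the set of labels of runs. A monoid $(K,+,\mathbb 0)$ is complete if it is equipped with sums $\sum_{i\in I}k_i\in K$ for all index sets $I$ and all families $(k_i)_{i\in I}$ in $K$ such that $\sum_{i\in\emptyset}k_i=\mathbb 0$, $\sum_{i\in\{j\}}k_i=k_j$, $\sum_{i\in\{p,q\}}k_i=k_p+k_q$ for $p\ne q$, and $\sum_{j\in J}\sum_{i\in I_j}k_i=\sum_{i\in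 I}k_i$ whenever $I=\bigcup_{j\in J}I_j$ with the $I_j$ pairwise disjoint. A valuation structure $\mathbb V=(M,(K,+,\mathbb 0),\mathrm{val})$ consists of a non-empty set $M$, a complete monoid $(K,+,\mathbb 0)$ and a map $\mathrm{val}:M^\omega\to K$. A weighted Büchi automaton (WBA) $\mathcal A$ over $\Sigma$ and $\mathbb V$ is a Büchi automaton $(Q,I,T,F)$ over $\Sigma$ with a map $\mathrm{wt}:T\to M$; its behavior is $$[\![\mathcal A]\!]:\Sigma^\omega\to K,\qquad [\![\mathcal A]\!](w)=\sum\big(\mathrm{val}((\mathrm{wt}(t_i))_{i\in\mathbb N})\;\big|\;\rho=(t_i)_{i\in\mathbb N}\text{ a run with label }w\big).$$ It is unambiguous if every $w\in\Sigma^\omega$ is the label of at most one run. A map $\mathbb L:\Sigma^\omega\to K$ is (nondeterministically) recognizable over $\mathbb V$ if $\mathbb L=[\![\mathcal A]\!]$ for some WBA $\mathcal A$ over $\Sigma$ and $\mathbb V$, and unambiguously recognizable over $\mathbb V$ if $\mathcal A$ can be chosen unambiguous. Let $\Gamma$ be an alphabet and let $h:\Gamma\to\Sigma$, $g:\Gamma\to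 M$ be maps (renamings), applied letterwise to $\omega$-words. For $\mathcal L\subseteq\Gamma^\omega$ and $\mathbb L':\Gamma^\omega\to K$, put $(\mathrm{val}\circ g)(u)=\mathrm{val}(g(u))$; let $(\mathbb L'\cap\mathcal L)(u)$ be $\mathbb L'(u)$ if $u\in\mathcal L$ and $\mathbb 0$ otherwise; and let $h(\mathbb L')(w)=\sum\big(\mathbb L'(u)\mid u\in\Gamma^\omega,\ h(u)=w\big)$ for $w\in\Sigma^\omega$. The $\omega$-language $\mathcal L$ is $h$-unambiguous if for every $w\in\Sigma^\omega$ there is at most one $u\in\mathcal L$ with $h(u)=w$. *Statement.* Let $\Sigma$ be an alphabet, $\mathbb V=(M,(K,+,\mathbb 0),\mathrm{val})$ a valuation structure and $\mathbb L:\Sigma^\omega\to K$ a map. Then: (a) $\mathbb L$ is unambiguously recognizable over $\mathbb V$ if and only if there exist an alphabet $\Gamma$, renamings $h:\Gamma\to\Sigma$ and $g:\Gamma\to M$, and a recognizable and $h$-unambiguous $\omega$-language $\mathcal L\subseteq\Gamma^\omega$ such that $\mathbb L=h((\mathrm{val}\circ g)\cap\mathcal L)$. (b) $\mathbb L$ is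 nondeterministically recognizable over $\mathbb V$ if and only if there exist an alphabet $\Gamma$, renamings $h:\Gamma\to\Sigma$ and $g:\Gamma\to M$, and a recognizable $\omega$-language $\mathcal L\subseteq\Gamma^\omega$ such that $\mathbb L=h((\mathrm{val}\circ g)\cap\mathcal L)$. -/

import Mathlib

universe u v w

namespace WBA

/-- A complete monoid structure on the monoid `K`: infinitary sums over all index sets
(the types of a universe) which extend the finite sums and respect all partitions of the
index set (blocks may be empty). Commutativity of `K` is a consequence. -/
structure CompleteMonoid (K : Type w) [AddMonoid K] where
  sum : {ι : Type u} → (ι → K) → K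
  sum_empty : ∀ {ι : Type u} (k : ι → K), IsEmpty ι → sum k = 0
  sum_singleton : ∀ {ι : Type u} (k : ι → K) (j : ι), (∀ i, i = j) → sum k = k j
  sum_pair : ∀ {ι : Type u} (k : ι → K) (p q : ι), p ≠ q → (∀ i, i = p ∨ i = q) →
    sum k = k p + k q
  sum_partition : ∀ {ι κ : Type u} (k : ι → K) (B : κ → Set ι),
    (⋃ j, B j) = Set.univ → (∀ j j', j ≠ j' → Disjoint (B j) (B j')) →
    sum (fun j : κ => sum (fun i : B j => k i)) = sum k

/-- A valuation structure `(M, K, val)`: a non-empty set `M` of transition weights, a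
complete monoid `K` and a valuation function on the `ω`-words over `M`. -/
structure ValuationStructure (M : Type v) (K : Type w) [AddMonoid K]
    extends CompleteMonoid.{u, w} K where
  nonempty_weights : Nonempty M
  val : (ℕ → M) → K

/-- A Büchi automaton over `S`: a finite set of states, initial states, transitions,
accepting states. -/
structure BuchiAutomaton (S : Type u) where
  Q : Type u
  finite_states : Finite Q
  I : Set Q
  T : Set (Q × S × Q)
  F : Set Q

namespace BuchiAutomaton

variable {S : Type u}

/-- An infinite sequence of matching transitions, starting in an initial state and visiting
some accepting state infinitely often. -/
def IsRun (A : BuchiAutomaton S) (ρ : ℕ → A.T) : Prop :=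
  ∃ q : ℕ → A.Q,
    (∀ i, (ρ i).1.1 = q i ∧ (ρ i).1.2.2 = q (i + 1)) ∧
    q 0 ∈ A.I ∧
    ({p : A.Q | {i : ℕ | p = q i}.Infinite} ∩ A.F).Nonempty

/-- The label of a sequence of transitions. -/
def label (A : BuchiAutomaton S) (ρ : ℕ → A.T) : ℕ → S := fun i => (ρ i).1.2.1

/-- The set of all runs with label `x`. -/
def runs (A : BuchiAutomaton S) (x : ℕ → S) : Set (ℕ → A.T) :=
  {ρ | A.IsRun ρ ∧ A.label ρ = x}

/-- The accepted `ω`-language. -/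
def language (A : BuchiAutomaton S) : Set (ℕ → S) := {x | (A.runs x).Nonempty}

/-- There is at most one run on every `ω`-word. -/
def Unambiguous (A : BuchiAutomaton S) : Prop := ∀ x : ℕ → S, (A.runs x).Subsingleton

end BuchiAutomaton

/-- A recognizable `ω`-language. -/
def Recognizable {S : Type u} (R : Set (ℕ → S)) : Prop :=
  ∃ A : BuchiAutomaton S, A.language = R

/-- A weighted Büchi automaton over `S` with transition weights in `M`. -/
structure WeightedBuchiAutomaton (S : Type u) (M : Type v) extends BuchiAutomaton S where
  wt : T → M

section Weighted

variable {S : Type u} {M : Type v} {K : Type w} [AddMonoid K]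

/-- The weight of a run. -/
def WeightedBuchiAutomaton.runWeight (A : WeightedBuchiAutomaton S M)
    (V : ValuationStructure.{u, v, w} M K) (ρ : ℕ → A.T) : K :=
  V.val (fun i => A.wt (ρ i))

/-- The behavior of a weighted Büchi automaton: the sum of the weights of all runs. -/
def WeightedBuchiAutomaton.behavior (A : WeightedBuchiAutomaton S M)
    (V : ValuationStructure.{u, v, w} M K) : (ℕ → S) → K :=
  fun x => V.sum (fun ρ : A.runs x => A.runWeight V ρ.1)

/-- Nondeterministic recognizability of a quantitative `ω`-language over `V`. -/
def QRecognizable (V : ValuationStructure.{u, v, w} M K) (L : (ℕ → S) → K) : Prop :=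
  ∃ A : WeightedBuchiAutomaton S M, A.behavior V = L

/-- Unambiguous recognizability of a quantitative `ω`-language over `V`. -/
def UnambiguouslyQRecognizable (V : ValuationStructure.{u, v, w} M K)
    (L : (ℕ → S) → K) : Prop :=
  ∃ A : WeightedBuchiAutomaton S M, A.Unambiguous ∧ A.behavior V = L

end Weighted

/-- Letterwise application of a renaming to an `ω`-word. -/
def renameWord {G : Type*} {D : Type*} (h : G → D) (x : ℕ → G) : ℕ → D := fun i => h (x i)

/-- The renaming `h(L)` of a quantitative `ω`-language, summing over all preimages. -/
def renameLanguage {G S : Type u} {M : Type v} {K : Type w} [AddMonoid K]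
    (V : ValuationStructure.{u, v, w} M K) (h : G → S) (L : (ℕ → G) → K) : (ℕ → S) → K :=
  fun x => V.sum (fun y : {y : ℕ → G // renameWord h y = x} => L y.1)

/-- The composition `val ∘ g`. -/
def valComp {G : Type u} {M : Type v} {K : Type w} [AddMonoid K]
    (V : ValuationStructure.{u, v, w} M K) (g : G → M) : (ℕ → G) → K :=
  fun y => V.val (renameWord g y)

open Classical in
/-- The intersection of a quantitative `ω`-language with an `ω`-language. -/
noncomputable def inter {G : Type u} {K : Type w} [AddMonoid K]
    (L : (ℕ → G) → K) (R : Set (ℕ → G)) : (ℕ → G) → K :=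
  fun y => if y ∈ R then L y else 0

/-- Every `ω`-word has at most one preimage under `h` in `R`. -/
def HUnambiguous {G S : Type u} (h : G → S) (R : Set (ℕ → G)) : Prop :=
  ∀ x : ℕ → S, ∀ y ∈ R, ∀ y' ∈ R, renameWord h y = x → renameWord h y' = x → y = y'

end WBA

/-! From automaton to renaming, `Γ` is the set of transitions, the language consists of the runs,
`h` reads off labels and `g` weights. Conversely, a Büchi automaton for the language is relabelled
by `h`, guessing the letters of `Γ`. Each word must be counted exactly once in the sum, so even (b)
requires that automaton to be unambiguous (`Recognizable.exists_unambiguous`); its accepting runs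
then correspond bijectively to the words of the language.

For unambiguity, annotate each position with the set of states rejecting the remaining suffix. These
sets arise from finitely many nested least fixed points of backward equations `s i = ψ (x i) (s (i +
1))`. A Büchi transducer can guess such a solution and verify its minimality with exactly one
accepting run per word (`prophetic_leastSolution`), and such transducers compose (`Prophetic.comp`).
At most `Nat.card A.Q + 1` rounds are needed, because every incomplete round adds a state at all
late positions. -/

namespace WBA

open Filter

/-! ### Transducers with exactly one accepting run per word -/

section Prophetic

/-- State sequences of a Büchi automaton, given by its components, that accept a word. -/
structure IsAcceptingRun {Q X : Type*} (I F : Set Q) (T : Q → X → Q → Prop) (x : ℕ → X)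
    (q : ℕ → Q) : Prop where
  init : q 0 ∈ I
  step : ∀ i, T (q i) (x i) (q (i + 1))
  acc : ∃ᶠ i in atTop, q i ∈ F

/-- A letter-to-letter map on `ω`-words computed by a finite transducer with Büchi acceptance
that has exactly one accepting run on every word. -/
def Prophetic {X Y : Type u} (Φ : (ℕ → X) → ℕ → Y) : Prop :=
  ∃ (Q : Type u) (_ : Finite Q) (I F : Set Q) (T : Q → X → Q → Prop) (o : Q → Y),
    ∀ x, ∃ q, IsAcceptingRun I F T x q ∧ (∀ i, o (q i) = Φ x i) ∧
      ∀ q', IsAcceptingRun I F T x q' → q' = q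

theorem Prophetic.map {X Y Z : Type u} {Φ : (ℕ → X) → ℕ → Y} (hΦ : Prophetic Φ) (f : Y → Z) :
    Prophetic (fun x i => f (Φ x i)) := by
  obtain ⟨Q, hQ, I, F, T, o, h⟩ := hΦ
  refine ⟨Q, hQ, I, F, T, f ∘ o, fun x => ?_⟩
  obtain ⟨q, hq, ho, hu⟩ := h x
  exact ⟨q, hq, fun i => congrArg f (ho i), hu⟩

theorem Prophetic.const {X Y : Type u} (y : Y) : Prophetic (fun (_ : ℕ → X) (_ : ℕ) => y) :=
  ⟨PUnit, inferInstance, Set.univ, Set.univ, fun _ _ _ => True, fun _ => y, fun _ =>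
    ⟨fun _ => PUnit.unit, ⟨trivial, fun _ => trivial, Frequently.of_forall fun _ => trivial⟩,
      fun _ => rfl, fun _ _ => rfl⟩⟩

/-- Alternating between waiting for `p` and waiting for `r` detects that both hold infinitely
often. -/
theorem frequently_alternating_iff {p r b : ℕ → Prop}
    (hb : ∀ i, b (i + 1) ↔ (b i ∧ ¬ r i) ∨ (¬ b i ∧ p i)) :
    (∃ᶠ i in atTop, ¬ b i ∧ p i) ↔ (∃ᶠ i in atTop, p i) ∧ ∃ᶠ i in atTop, r i := by
  constructor
  · refine fun h => ⟨h.mono fun _ => And.right, fun hr => ?_⟩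
    obtain ⟨N, hN⟩ := eventually_atTop.1 hr
    obtain ⟨i, hi, hi'⟩ := frequently_atTop.1 h N
    have hstay : ∀ j, i + 1 ≤ j → b j := by
      intro j hj
      induction j, hj using Nat.le_induction with
      | base => exact (hb i).2 (Or.inr hi')
      | succ j hj ih => exact (hb j).2 (Or.inl ⟨ih, hN j (by omega)⟩)
    obtain ⟨j, hj, hj'⟩ := frequently_atTop.1 h (i + 1)
    exact hj'.1 (hstay j hj)
  · rintro ⟨hp, hr⟩ hn
    obtain ⟨N, hN⟩ := eventually_atTop.1 hn
    have hall : ∀ i, N ≤ i → b i := by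
      intro i hi
      by_contra hbi
      have hstay : ∀ j, i ≤ j → ¬ b j := by
        intro j hj
        induction j, hj using Nat.le_induction with
        | base => exact hbi
        | succ j hj ih =>
          rw [hb]
          have := hN j (by omega)
          tauto
      obtain ⟨j, hj, hj'⟩ := frequently_atTop.1 hp i
      exact hN j (by omega) ⟨hstay j hj, hj'⟩
    obtain ⟨j, hj, hj'⟩ := frequently_atTop.1 hr N
    have h1 := (hb j).1 (hall (j + 1) (by omega))
    have h2 := hall j hj
    tauto

/-- Product construction in which the second machine reads the output of the first. The bit records
which Büchi condition is awaited; its start and updates are deterministic, so uniqueness of the run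
survives. -/
theorem Prophetic.comp {X Y Z : Type u} {Φ : (ℕ → X) → ℕ → Y} {Ψ : (ℕ → X × Y) → ℕ → Z}
    (hΨ : Prophetic Ψ) (hΦ : Prophetic Φ) :
    Prophetic (fun x => Ψ (fun i => (x i, Φ x i))) := by
  obtain ⟨Q₁, _, I₁, F₁, T₁, o₁, h₁⟩ := hΦ
  obtain ⟨Q₂, _, I₂, F₂, T₂, o₂, h₂⟩ := hΨ
  let flag (s : Q₁ × Q₂ × Prop) : Prop := (s.2.2 ∧ s.2.1 ∉ F₂) ∨ (¬ s.2.2 ∧ s.1 ∈ F₁)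
  refine ⟨Q₁ × Q₂ × Prop, inferInstance, {s | s.1 ∈ I₁ ∧ s.2.1 ∈ I₂ ∧ ¬ s.2.2},
    {s | ¬ s.2.2 ∧ s.1 ∈ F₁},
    fun s a s' => T₁ s.1 a s'.1 ∧ T₂ s.2.1 (a, o₁ s.1) s'.2.1 ∧ (s'.2.2 ↔ flag s),
    fun s => o₂ s.2.1, fun x => ?_⟩
  obtain ⟨q₁, r₁, e₁, u₁⟩ := h₁ x
  obtain ⟨q₂, r₂, e₂, u₂⟩ := h₂ (fun i => (x i, Φ x i))
  let b : ℕ → Prop := fun i => Nat.rec False (fun i c => flag (q₁ i, q₂ i, c)) i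
  refine ⟨fun i => (q₁ i, q₂ i, b i), ⟨⟨r₁.init, r₂.init, not_false⟩, fun i => ?_, ?_⟩, e₂, ?_⟩
  · refine ⟨r₁.step i, ?_, Iff.rfl⟩
    have := r₂.step i
    rwa [← e₁ i] at this
  · exact (frequently_alternating_iff (p := fun i => q₁ i ∈ F₁) (r := fun i => q₂ i ∈ F₂)
      (b := b) fun i => Iff.rfl).2 ⟨r₁.acc, r₂.acc⟩
  · intro s hs
    have hf := (frequently_alternating_iff (p := fun i => (s i).1 ∈ F₁)
      (r := fun i => (s i).2.1 ∈ F₂) (b := fun i => (s i).2.2) fun i => (hs.step i).2.2).1 hs.acc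
    have h1 : (fun i => (s i).1) = q₁ := u₁ _ ⟨hs.init.1, fun i => (hs.step i).1, hf.1⟩
    have h2 : (fun i => (s i).2.1) = q₂ := by
      refine u₂ _ ⟨hs.init.2.1, fun i => ?_, hf.2⟩
      have := (hs.step i).2.1
      rwa [congrFun h1 i, e₁ i] at this
    have h3 : ∀ i, (s i).2.2 = b i := by
      intro i
      induction i with
      | zero => exact eq_false hs.init.2.2
      | succ i ih =>
        rw [propext (hs.step i).2.2]
        change flag (s i) = flag (q₁ i, q₂ i, b i)
        rw [← ih, ← congrFun h1 i, ← congrFun h2 i]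
    funext i
    exact Prod.ext (congrFun h1 i) (Prod.ext (congrFun h2 i) (h3 i))

end Prophetic

/-! ### Least solutions of backward equations -/

section LeastSolution

variable {X Z : Type*}

/-- The composition of the maps attached to the `n` letters of `x` from position `i` on. -/
def iterFrom (ψ : X → Z → Z) (x : ℕ → X) : ℕ → ℕ → Z → Z
  | _, 0 => id
  | i, n + 1 => ψ (x i) ∘ iterFrom ψ x (i + 1) n

theorem iterFrom_succ_right (ψ : X → Z → Z) (x : ℕ → X) (i n : ℕ) :
    iterFrom ψ x i (n + 1) = iterFrom ψ x i n ∘ ψ (x (i + n)) := by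
  induction n generalizing i with
  | zero => rfl
  | succ n ih =>
    rw [iterFrom, ih, iterFrom, show i + 1 + n = i + (n + 1) by omega]
    rfl

theorem eq_iterFrom_apply {ψ : X → Z → Z} {x : ℕ → X} {s : ℕ → Z}
    (hs : ∀ i, s i = ψ (x i) (s (i + 1))) (i n : ℕ) : s i = iterFrom ψ x i n (s (i + n)) := by
  induction n with
  | zero => rfl
  | succ n ih => rw [iterFrom_succ_right, Function.comp_apply, ih, hs (i + n), add_assoc]

variable [CompleteLattice Z]

/-- The least solution `s` of the equations `s i = ψ (x i) (s (i + 1))`. -/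
def leastSolution (ψ : X → Z → Z) (x : ℕ → X) (i : ℕ) : Z := ⨆ n, iterFrom ψ x i n ⊥

theorem iterFrom_bot_le_leastSolution (ψ : X → Z → Z) (x : ℕ → X) (i n : ℕ) :
    iterFrom ψ x i n ⊥ ≤ leastSolution ψ x i :=
  le_iSup (fun n => iterFrom ψ x i n ⊥) n

variable {ψ : X → Z → Z} (hψ : ∀ a, Monotone (ψ a))

include hψ

theorem monotone_iterFrom (x : ℕ → X) (i n : ℕ) : Monotone (iterFrom ψ x i n) := by
  induction n generalizing i with
  | zero => exact monotone_id
  | succ n ih => exact (hψ _).comp (ih _)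

theorem leastSolution_le {x : ℕ → X} {s : ℕ → Z} (hs : ∀ i, ψ (x i) (s (i + 1)) ≤ s i) (i : ℕ) :
    leastSolution ψ x i ≤ s i := by
  refine iSup_le fun n => ?_
  induction n generalizing i with
  | zero => exact bot_le
  | succ n ih => exact (hψ _ (ih (i + 1))).trans (hs i)

theorem iterFrom_bot_mono (x : ℕ → X) (i : ℕ) : Monotone (fun n => iterFrom ψ x i n ⊥) := by
  refine monotone_nat_of_le_succ fun n => ?_
  rw [iterFrom_succ_right]
  exact monotone_iterFrom hψ x i n bot_le

variable [Finite Z]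

theorem exists_iterFrom_bot_eq_leastSolution (x : ℕ → X) (i : ℕ) :
    ∃ N, ∀ n, N ≤ n → iterFrom ψ x i n ⊥ = leastSolution ψ x i := by
  obtain ⟨N, hN⟩ := WellFoundedGT.monotone_chain_condition ⟨_, iterFrom_bot_mono hψ x i⟩
  refine ⟨N, fun n hn => (iterFrom_bot_le_leastSolution ψ x i n).antisymm (iSup_le fun m => ?_)⟩
  calc iterFrom ψ x i m ⊥ ≤ iterFrom ψ x i (max N m) ⊥ :=
        iterFrom_bot_mono hψ x i (le_max_right N m)
    _ = iterFrom ψ x i N ⊥ := (hN _ (le_max_left N m)).symm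
    _ = iterFrom ψ x i n ⊥ := hN n hn
    _ ≤ _ := le_rfl

/-- Finiteness replaces continuity: the chains at `i` and `i + 1` both become stationary. -/
theorem leastSolution_eq (x : ℕ → X) (i : ℕ) :
    leastSolution ψ x i = ψ (x i) (leastSolution ψ x (i + 1)) := by
  obtain ⟨N, hN⟩ := exists_iterFrom_bot_eq_leastSolution hψ x i
  obtain ⟨N', hN'⟩ := exists_iterFrom_bot_eq_leastSolution hψ x (i + 1)
  rw [← hN (max N N' + 1) (by omega), ← hN' (max N N') (by omega)]
  rfl

/-- A solution that is infinitely often reached from `⊥` is the least one. -/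
theorem eq_leastSolution {x : ℕ → X} {s : ℕ → Z} (hs : ∀ i, s i = ψ (x i) (s (i + 1)))
    (hr : ∀ c, ∃ r n, c ≤ r ∧ iterFrom ψ x r n ⊥ = s r) : s = leastSolution ψ x := by
  funext i
  obtain ⟨r, n, hr, hn⟩ := hr i
  obtain ⟨m, rfl⟩ := Nat.exists_eq_add_of_le hr
  -- Both solutions are pulled back from `r = i + m` by the same map, so agreement at `r` suffices.
  rw [eq_iterFrom_apply hs i m, eq_iterFrom_apply (leastSolution_eq hψ x) i m]
  congr 1
  refine le_antisymm (hn ▸ iterFrom_bot_le_leastSolution ψ x _ n) ?_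
  exact leastSolution_le hψ (fun j => (hs j).ge) _

end LeastSolution

/-- A state holds the guessed value, the composite of the maps read since a checkpoint, and the
value guessed at that checkpoint. It is accepting when the composite sends `⊥` to the stored value;
the checkpoint then moves to the current position. Infinitely many successes force the guess to be
least, by `eq_leastSolution`. -/
theorem prophetic_leastSolution {X Z : Type u} [CompleteLattice Z] [Finite Z] {ψ : X → Z → Z}
    (hψ : ∀ a, Monotone (ψ a)) : Prophetic (leastSolution ψ) := by
  classical
  let next (a : X) (s : Z × (Z → Z) × Z) : (Z → Z) × Z :=
    if s.2.1 ⊥ = s.2.2 then (ψ a, s.1) else (s.2.1 ∘ ψ a, s.2.2)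
  let T (s : Z × (Z → Z) × Z) (a : X) (s' : Z × (Z → Z) × Z) : Prop :=
    s.1 = ψ a s'.1 ∧ s'.2 = next a s
  let I : Set (Z × (Z → Z) × Z) := {s | s.2 = (id, s.1)}
  let F : Set (Z × (Z → Z) × Z) := {s | s.2.1 ⊥ = s.2.2}
  -- At position `i` the current checkpoint is `r ≥ c`, and `n` letters have been read since.
  let Inv (x : ℕ → X) (s : ℕ → Z × (Z → Z) × Z) (c i : ℕ) : Prop :=
    ∃ r n, c ≤ r ∧ r + n = i ∧ (s i).2 = (iterFrom ψ x r n, (s r).1)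
  have reset : ∀ {x : ℕ → X} {s : ℕ → Z × (Z → Z) × Z}, (∀ i, T (s i) (x i) (s (i + 1))) → ∀ i, s i ∈ F → Inv x s i (i + 1) := by
    intro x s hs i hi
    exact ⟨i, 1, le_rfl, rfl, (hs i).2.trans (if_pos hi)⟩
  have keep : ∀ {x : ℕ → X} {s : ℕ → Z × (Z → Z) × Z}, (∀ i, T (s i) (x i) (s (i + 1))) → ∀ i, s i ∉ F →
      ∀ r n, r + n = i → (s i).2 = (iterFrom ψ x r n, (s r).1) →
        (s (i + 1)).2 = (iterFrom ψ x r (n + 1), (s r).1) := by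
    intro x s hs i hi r n hrn h
    rw [(hs i).2, iterFrom_succ_right, hrn]
    refine (if_neg hi).trans ?_
    rw [h]
  have step : ∀ {x : ℕ → X} {s : ℕ → Z × (Z → Z) × Z}, (∀ i, T (s i) (x i) (s (i + 1))) → ∀ c i, c ≤ i → Inv x s c i →
      Inv x s c (i + 1) := by
    rintro x s hs c i hci ⟨r, n, hcr, hrn, h⟩
    by_cases hi : s i ∈ F
    · exact ⟨i, 1, hci, rfl, (hs i).2.trans (if_pos hi)⟩
    · exact ⟨r, n + 1, hcr, by omega, keep hs i hi r n hrn h⟩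
  refine ⟨Z × (Z → Z) × Z, inferInstance, I, F, T, Prod.fst, fun x => ?_⟩
  let d : ℕ → (Z → Z) × Z := fun i =>
    Nat.rec (id, leastSolution ψ x 0) (fun i e => next (x i) (leastSolution ψ x i, e)) i
  let q : ℕ → Z × (Z → Z) × Z := fun i => (leastSolution ψ x i, d i)
  have hq : ∀ i, T (q i) (x i) (q (i + 1)) := fun i => ⟨leastSolution_eq hψ x i, rfl⟩
  refine ⟨q, ⟨rfl, hq, fun hn => ?_⟩, fun _ => rfl, fun s hs => ?_⟩
  · obtain ⟨N, hN⟩ := eventually_atTop.1 hn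
    have hinv : ∀ i, Inv x q 0 i := by
      intro i
      induction i with
      | zero => exact ⟨0, 0, le_rfl, rfl, rfl⟩
      | succ i ih => exact step hq 0 i (Nat.zero_le i) ih
    obtain ⟨r, n, -, hrn, h⟩ := hinv N
    -- Without further success the checkpoint `r` stays fixed while the composite lengthens, until
    -- it reaches the least solution at `r` from `⊥`.
    have hall : ∀ m, (q (N + m)).2 = (iterFrom ψ x r (n + m), (q r).1) := by
      intro m
      induction m with
      | zero => exact h
      | succ m ih => exact keep hq (N + m) (hN _ (by omega)) r (n + m) (by omega) ih
    obtain ⟨N', hN'⟩ := exists_iterFrom_bot_eq_leastSolution hψ x r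
    refine hN (N + N') (by omega) ?_
    change (q (N + N')).2.1 ⊥ = (q (N + N')).2.2
    rw [hall N']
    exact hN' (n + N') (by omega)
  · have hfst : (fun i => (s i).1) = leastSolution ψ x := by
      refine eq_leastSolution hψ (fun i => (hs.step i).1) fun c => ?_
      obtain ⟨i, hci, hi⟩ := frequently_atTop.1 hs.acc c
      have hinv : ∀ j, i + 1 ≤ j → Inv x s i j := by
        intro j hj
        induction j, hj using Nat.le_induction with
        | base => exact reset hs.step i hi
        | succ j hj ih => exact step hs.step i j (by omega) ih
      -- The success at `j` tests a checkpoint set no earlier than `i`, hence beyond `c`.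
      obtain ⟨j, hij, hj⟩ := frequently_atTop.1 hs.acc (i + 1)
      obtain ⟨r, n, hir, -, h⟩ := hinv j hij
      refine ⟨r, n, hci.trans hir, ?_⟩
      have hj' : (s j).2.1 ⊥ = (s j).2.2 := hj
      rwa [h] at hj'
    have hsnd : ∀ i, (s i).2 = d i := by
      intro i
      induction i with
      | zero =>
        have h0 : (s 0).2 = (id, (s 0).1) := hs.init
        rw [h0, congrFun hfst 0]
        rfl
      | succ i ih =>
        rw [(hs.step i).2]
        change next (x i) (s i) = next (x i) (leastSolution ψ x i, d i)
        rw [← ih, ← congrFun hfst i]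
    funext i
    exact Prod.ext (congrFun hfst i) (hsnd i)

/-! ### Rejecting states as an iterated fixed point -/

namespace BuchiAutomaton

variable {S : Type u} (A : BuchiAutomaton S)

/-- The state `q` accepts the suffix of `x` that starts at position `i`. -/
def AcceptsFrom (x : ℕ → S) (i : ℕ) (q : A.Q) : Prop :=
  ∃ p : ℕ → A.Q, p 0 = q ∧ (∀ j, (p j, x (i + j), p (j + 1)) ∈ A.T) ∧ ∃ᶠ j in atTop, p j ∈ A.F

/-- The states that do not accept the suffix of `x` that starts at position `i`. -/
def rejecting (x : ℕ → S) (i : ℕ) : Set A.Q := {q | ¬ A.AcceptsFrom x i q}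

/-- States of `a.2`, and states all of whose successors lie in `Y`. -/
def forcedStep (a : S × Set A.Q) (Y : Set A.Q) : Set A.Q :=
  a.2 ∪ {q | ∀ q', (q, a.1, q') ∈ A.T → q' ∈ Y}

/-- States outside `a.2` that are accepting or have a successor in `Y`. -/
def escapeStep (a : S × Set A.Q) (Y : Set A.Q) : Set A.Q :=
  {q | q ∉ a.2 ∧ (q ∈ A.F ∨ ∃ q', (q, a.1, q') ∈ A.T ∧ q' ∈ Y)}

theorem monotone_forcedStep (a : S × Set A.Q) : Monotone (A.forcedStep a) :=
  fun _ _ h => Set.union_subset_union_right _ fun _ hq q' hq' => h (hq q' hq')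

theorem monotone_escapeStep (a : S × Set A.Q) : Monotone (A.escapeStep a) :=
  fun _ _ h _ hq => ⟨hq.1, hq.2.imp_right fun ⟨q', hq', hY⟩ => ⟨q', hq', h hY⟩⟩

/-- The states all of whose paths are finite or reach `P`. -/
def forced (x : ℕ → S) (P : ℕ → Set A.Q) : ℕ → Set A.Q :=
  leastSolution A.forcedStep fun i => (x i, P i)

/-- The states that can reach an accepting state while avoiding `P`. -/
def escaping (x : ℕ → S) (P : ℕ → Set A.Q) : ℕ → Set A.Q :=
  leastSolution A.escapeStep fun i => (x i, P i)

/-- Approximations from below of the sets of rejecting states. -/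
def rejectingApprox (x : ℕ → S) : ℕ → ℕ → Set A.Q
  | 0 => fun _ => ∅
  | k + 1 => fun i => (A.escaping x (A.forced x (rejectingApprox x k)) i)ᶜ

variable {A} {x : ℕ → S} {P : ℕ → Set A.Q}

theorem AcceptsFrom.suffix {i : ℕ} {p : ℕ → A.Q} (hp : ∀ j, (p j, x (i + j), p (j + 1)) ∈ A.T)
    (hF : ∃ᶠ j in atTop, p j ∈ A.F) (m : ℕ) : A.AcceptsFrom x (i + m) (p m) := by
  refine ⟨fun j => p (m + j), rfl, fun j => by simpa [add_assoc] using hp (m + j), ?_⟩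
  rw [frequently_atTop] at hF ⊢
  intro c
  obtain ⟨j, hj, hj'⟩ := hF (m + c)
  obtain ⟨d, rfl⟩ := Nat.exists_eq_add_of_le (show m ≤ j by omega)
  exact ⟨d, by omega, hj'⟩

theorem forced_subset_rejecting (hP : ∀ i, P i ⊆ A.rejecting x i) (i : ℕ) :
    A.forced x P i ⊆ A.rejecting x i := by
  refine leastSolution_le A.monotone_forcedStep (s := A.rejecting x) (fun i => ?_) i
  refine Set.union_subset (hP i) ?_
  rintro q hq ⟨p, rfl, hp, hF⟩
  exact hq (p 1) (hp 0) (AcceptsFrom.suffix hp hF 1)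

variable [Finite A.Q]

theorem forced_eq (x : ℕ → S) (P : ℕ → Set A.Q) (i : ℕ) :
    A.forced x P i = A.forcedStep (x i, P i) (A.forced x P (i + 1)) :=
  leastSolution_eq A.monotone_forcedStep _ i

theorem escaping_eq (x : ℕ → S) (P : ℕ → Set A.Q) (i : ℕ) :
    A.escaping x P i = A.escapeStep (x i, P i) (A.escaping x P (i + 1)) :=
  leastSolution_eq A.monotone_escapeStep _ i

theorem subset_forced (i : ℕ) : P i ⊆ A.forced x P i := by
  rw [forced_eq]
  exact Set.subset_union_left

theorem subset_compl_escaping (i : ℕ) : P i ⊆ (A.escaping x P i)ᶜ := by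
  intro q hq h
  rw [escaping_eq] at h
  exact h.1 hq

/-- All states on an accepting path accept their suffixes, so the path avoids `P`; as it also meets
`A.F`, its start escapes. -/
theorem compl_escaping_subset_rejecting (hP : ∀ i, P i ⊆ A.rejecting x i) (i : ℕ) :
    (A.escaping x P i)ᶜ ⊆ A.rejecting x i := by
  rintro q hq ⟨p, rfl, hp, hF⟩
  refine hq ?_
  obtain ⟨n, -, hn⟩ := frequently_atTop.1 hF 0
  have hnot : ∀ m, p m ∉ P (i + m) := fun m hm => hP _ hm (AcceptsFrom.suffix hp hF m)
  have hmem : ∀ m, m ≤ n → p m ∈ A.escaping x P (i + m) := by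
    intro m hm
    induction hm using Nat.decreasingInduction with
    | self =>
      rw [escaping_eq]
      exact ⟨hnot n, Or.inl hn⟩
    | of_succ m _ ih =>
      rw [escaping_eq]
      exact ⟨hnot m, Or.inr ⟨_, hp m, ih⟩⟩
  exact hmem 0 (Nat.zero_le n)

theorem exists_step_of_notMem_forced {i : ℕ} {q : A.Q} (h : q ∉ A.forced x P i) :
    ∃ q', (q, x i, q') ∈ A.T ∧ q' ∉ A.forced x P (i + 1) := by
  rw [forced_eq] at h
  by_contra! hn
  exact h (Or.inr hn)

/-- If the rejecting states are not all forced, then one of those left cannot reach an accepting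
state without meeting a forced one. -/
theorem exists_notMem_escaping {i : ℕ} {q : A.Q} (hq : q ∈ A.rejecting x i)
    (hq' : q ∉ A.forced x P i) :
    ∃ j, ∃ r, r ∉ A.forced x P j ∧ r ∉ A.escaping x (A.forced x P) j := by
  by_contra! hall
  let E := A.escaping x (A.forced x P)
  let y : ℕ → S × Set A.Q := fun i => (x i, A.forced x P i)
  have hex : ∀ j r, r ∉ A.forced x P j → ∃ n, r ∈ iterFrom A.escapeStep y j n ⊥ := by
    intro j r hr
    obtain ⟨n, hn⟩ := exists_iterFrom_bot_eq_leastSolution A.monotone_escapeStep y j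
    refine ⟨n, ?_⟩
    rw [hn n le_rfl]
    exact hall j r hr
  -- If all unforced states escaped, always decreasing this distance to `A.F`, and taking any
  -- unforced successor once there, would give an accepting path from `q`.
  let rank (j : ℕ) (r : A.Q) : ℕ := sInf {n | r ∈ iterFrom A.escapeStep y j n ⊥}
  have hnext : ∀ j r, ∃ r', r ∉ A.forced x P j → (r, x j, r') ∈ A.T ∧
      r' ∉ A.forced x P (j + 1) ∧ (r ∉ A.F → rank (j + 1) r' < rank j r) := by
    intro j r
    by_cases hr : r ∉ A.forced x P j
    · by_cases hF : r ∈ A.F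
      · obtain ⟨r', h1, h2⟩ := exists_step_of_notMem_forced hr
        exact ⟨r', fun _ => ⟨h1, h2, fun h => (h hF).elim⟩⟩
      · have hmem : r ∈ iterFrom A.escapeStep y j (rank j r) ⊥ := Nat.sInf_mem (hex j r hr)
        obtain ⟨m, hm⟩ : ∃ m, rank j r = m + 1 := by
          refine Nat.exists_eq_succ_of_ne_zero fun h0 => ?_
          rw [h0] at hmem
          exact hmem
        rw [hm] at hmem
        obtain ⟨-, hF' | ⟨r', hT, hr'⟩⟩ := hmem
        · exact (hF hF').elim
        · refine ⟨r', fun _ => ⟨hT, ?_, fun _ => ?_⟩⟩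
          · intro hf
            have hle : iterFrom A.escapeStep y (j + 1) m ⊥ ⊆ E (j + 1) :=
              iterFrom_bot_le_leastSolution _ y (j + 1) m
            exact subset_compl_escaping (j + 1) hf (hle hr')
          · rw [hm]
            exact Nat.lt_succ_of_le (Nat.sInf_le hr')
    · exact ⟨r, fun h => (hr h).elim⟩
  choose next hnext using hnext
  let p : ℕ → A.Q := fun m => Nat.rec q (fun m r => next (i + m) r) m
  have hp : ∀ m, p m ∉ A.forced x P (i + m) := by
    intro m
    induction m with
    | zero => exact hq'
    | succ m ih => exact (hnext (i + m) (p m) ih).2.1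
  refine hq ⟨p, rfl, fun m => (hnext (i + m) (p m) (hp m)).1, fun hF => ?_⟩
  obtain ⟨N, hN⟩ := eventually_atTop.1 hF
  -- If `A.F` is not visited from `N` on, the rank drops at every step, which cannot continue
  -- forever.
  have hdesc : ∀ m, rank (i + (N + m)) (p (N + m)) + m ≤ rank (i + N) (p N) := by
    intro m
    induction m with
    | zero => exact le_rfl
    | succ m ih =>
      have h := (hnext (i + (N + m)) (p (N + m)) (hp _)).2.2 (hN _ (by omega))
      change rank (i + (N + (m + 1))) (p (N + (m + 1))) < _ at h
      omega
  have := hdesc (rank (i + N) (p N) + 1)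
  omega

/-- The witness propagates: an unforced state has an unforced successor, and if that one escaped, so
would the state itself. -/
theorem eventually_exists_mem_diff_forced {j : ℕ} {r : A.Q} (hr : r ∉ A.forced x P j)
    (hr' : r ∉ A.escaping x (A.forced x P) j) (i : ℕ) (hi : j ≤ i) :
    ∃ r, r ∉ A.forced x P i ∧ r ∉ A.escaping x (A.forced x P) i := by
  induction i, hi using Nat.le_induction with
  | base => exact ⟨r, hr, hr'⟩
  | succ i _ ih =>
    obtain ⟨s, hs, hs'⟩ := ih
    obtain ⟨t, hT, ht⟩ := exists_step_of_notMem_forced hs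
    refine ⟨t, ht, fun ht' => hs' ?_⟩
    rw [escaping_eq]
    exact ⟨hs, Or.inr ⟨t, hT, ht'⟩⟩

theorem rejectingApprox_subset (x : ℕ → S) (k i : ℕ) :
    A.rejectingApprox x k i ⊆ A.rejecting x i := by
  induction k generalizing i with
  | zero => exact Set.empty_subset _
  | succ k ih => exact compl_escaping_subset_rejecting (forced_subset_rejecting ih) i

/-- A round that leaves a rejecting state unforced somewhere gains a new state at every late
position, so the eventual size grows by at least one. -/
theorem rejectingApprox_eq_or_card_le (x : ℕ → S) (k : ℕ) :
    (∀ i, A.rejectingApprox x k i = A.rejecting x i) ∨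
      ∃ N, ∀ i, N ≤ i → k ≤ (A.rejectingApprox x k i).ncard := by
  induction k with
  | zero => exact Or.inr ⟨0, fun i _ => Nat.zero_le _⟩
  | succ k ih =>
    by_cases h : ∀ i, A.rejecting x i ⊆ A.forced x (A.rejectingApprox x k) i
    · exact Or.inl fun i => (rejectingApprox_subset x (k + 1) i).antisymm
        ((h i).trans (subset_compl_escaping i))
    · have hmono : ∀ i, A.rejectingApprox x k i ⊆ A.rejectingApprox x (k + 1) i :=
        fun i => (subset_forced i).trans (subset_compl_escaping i)
      rcases ih with ih | ⟨N, hN⟩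
      · refine (h fun i => ?_).elim
        rw [← ih i]
        exact subset_forced i
      · push Not at h
        obtain ⟨i, hi⟩ := h
        obtain ⟨q, hq, hq'⟩ := Set.not_subset.1 hi
        obtain ⟨j, r, hr, hr'⟩ := exists_notMem_escaping hq hq'
        refine Or.inr ⟨max N j, fun i hi => ?_⟩
        obtain ⟨s, hs, hs'⟩ := eventually_exists_mem_diff_forced hr hr' i (by omega)
        refine Nat.succ_le_of_lt ((hN i (by omega)).trans_lt ?_)
        refine Set.ncard_lt_ncard ((Set.ssubset_iff_of_subset (hmono i)).2 ⟨s, hs', ?_⟩)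
          (Set.toFinite _)
        exact fun h => hs (subset_forced i h)

theorem rejectingApprox_card_add_one (x : ℕ → S) (i : ℕ) :
    A.rejectingApprox x (Nat.card A.Q + 1) i = A.rejecting x i := by
  rcases rejectingApprox_eq_or_card_le (A := A) x (Nat.card A.Q + 1) with h | ⟨N, hN⟩
  · exact h i
  · have h1 := hN N le_rfl
    have h2 := Set.ncard_le_card (A.rejectingApprox x (Nat.card A.Q + 1) N)
    omega

theorem prophetic_rejectingApprox (k : ℕ) :
    Prophetic (fun x : ℕ → S => A.rejectingApprox x k) := by
  induction k with
  | zero => exact Prophetic.const _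
  | succ k ih =>
    have h1 : Prophetic (fun x => A.forced x (A.rejectingApprox x k)) :=
      (prophetic_leastSolution A.monotone_forcedStep).comp ih
    have h2 : Prophetic (fun x => A.escaping x (A.forced x (A.rejectingApprox x k))) :=
      (prophetic_leastSolution A.monotone_escapeStep).comp h1
    exact h2.map compl

theorem prophetic_rejecting : Prophetic A.rejecting := by
  have h := prophetic_rejectingApprox (A := A) (Nat.card A.Q + 1)
  rwa [show (fun x : ℕ → S => A.rejectingApprox x (Nat.card A.Q + 1)) = A.rejecting from
    funext fun x => funext fun i => rejectingApprox_card_add_one x i] at h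

end BuchiAutomaton

/-! ### Runs as state sequences, and unambiguous automata -/

theorem exists_infinite_mem_iff {Q : Type*} [Finite Q] (q : ℕ → Q) (F : Set Q) :
    ({p : Q | {i : ℕ | p = q i}.Infinite} ∩ F).Nonempty ↔ ∃ᶠ i in atTop, q i ∈ F := by
  rw [Nat.frequently_atTop_iff_infinite]
  constructor
  · rintro ⟨p, hp, hF⟩
    refine hp.mono fun i hi => ?_
    have hi' : p = q i := hi
    change q i ∈ F
    rwa [← hi']
  · intro h
    by_contra hn
    refine h ((Set.Finite.biUnion (Set.toFinite F) (t := fun p => {i | p = q i})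
      fun p hp => ?_).subset fun i hi => Set.mem_biUnion hi rfl)
    by_contra hinf
    exact hn ⟨p, hinf, hp⟩

namespace BuchiAutomaton

variable {S : Type u} (A : BuchiAutomaton S)

/-- The transition set as a relation. -/
def Step (p : A.Q) (a : S) (q : A.Q) : Prop := (p, a, q) ∈ A.T

/-- The sequence of source states of a sequence of transitions. -/
def states (ρ : ℕ → A.T) : ℕ → A.Q := fun i => (ρ i).1.1

variable {A}

theorem IsRun.apply_eq {ρ : ℕ → A.T} (h : A.IsRun ρ) (i : ℕ) :
    (ρ i).1 = (A.states ρ i, A.label ρ i, A.states ρ (i + 1)) := by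
  obtain ⟨q, hq, -⟩ := h
  exact Prod.ext rfl (Prod.ext rfl ((hq i).2.trans (hq (i + 1)).1.symm))

theorem eq_of_states_eq {x : ℕ → S} {ρ ρ' : ℕ → A.T} (h : ρ ∈ A.runs x) (h' : ρ' ∈ A.runs x)
    (hs : A.states ρ = A.states ρ') : ρ = ρ' := by
  funext i
  refine Subtype.ext ?_
  rw [h.1.apply_eq, h'.1.apply_eq, hs, h.2, h'.2]

theorem isAcceptingRun_states [Finite A.Q] {x : ℕ → S} {ρ : ℕ → A.T} (h : ρ ∈ A.runs x) :
    IsAcceptingRun A.I A.F A.Step x (A.states ρ) := by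
  obtain ⟨hρ, rfl⟩ := h
  have hstep := hρ.apply_eq
  obtain ⟨q, hq, h0, hF⟩ := hρ
  have hqs : A.states ρ = q := funext fun i => (hq i).1
  refine ⟨?_, fun i => ?_, ?_⟩
  · rwa [hqs]
  · have hm := (ρ i).2
    rwa [hstep i] at hm
  · rw [hqs]
    exact (exists_infinite_mem_iff q A.F).1 hF

theorem exists_run_of_isAcceptingRun [Finite A.Q] {x : ℕ → S} {q : ℕ → A.Q}
    (h : IsAcceptingRun A.I A.F A.Step x q) : ∃ ρ ∈ A.runs x, A.states ρ = q :=
  ⟨fun i => ⟨(q i, x i, q (i + 1)), h.step i⟩,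
    ⟨⟨q, fun _ => ⟨rfl, rfl⟩, h.init, (exists_infinite_mem_iff q A.F).2 h.acc⟩, rfl⟩, rfl⟩

theorem mem_language_iff [Finite A.Q] {x : ℕ → S} :
    x ∈ A.language ↔ ∃ q ∈ A.I, q ∉ A.rejecting x 0 := by
  constructor
  · rintro ⟨ρ, hρ⟩
    have h := isAcceptingRun_states hρ
    exact ⟨_, h.init, not_not.2 ⟨_, rfl, fun j => by simpa [Step] using h.step j, h.acc⟩⟩
  · rintro ⟨q, hI, hq⟩
    obtain ⟨p, rfl, hp, hF⟩ := not_not.1 hq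
    obtain ⟨ρ, hρ, -⟩ := exists_run_of_isAcceptingRun
      (show IsAcceptingRun A.I A.F A.Step x p from ⟨hI, fun j => by simpa [Step] using hp j, hF⟩)
    exact ⟨ρ, hρ⟩

end BuchiAutomaton

/-- Every recognizable `ω`-language is recognized with at most one accepting run per word. -/
theorem Recognizable.exists_unambiguous {X : Type u} {R : Set (ℕ → X)} (hR : Recognizable R) :
    ∃ (Q : Type u) (_ : Finite Q) (I F : Set Q) (T : Q → X → Q → Prop),
      (∀ x, x ∈ R ↔ ∃ q, IsAcceptingRun I F T x q) ∧
        ∀ x q q', IsAcceptingRun I F T x q → IsAcceptingRun I F T x q' → q = q' := by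
  obtain ⟨A, rfl⟩ := hR
  have := A.finite_states
  obtain ⟨Q, hQ, I, F, T, o, h⟩ := BuchiAutomaton.prophetic_rejecting (A := A)
  -- The output at position `0` is the set of rejecting states, so restricting the initial states of
  -- the transducer decides membership; its unique accepting run is either kept or lost.
  have hrun : ∀ x q, IsAcceptingRun {s ∈ I | ∃ p ∈ A.I, p ∉ o s} F T x q →
      IsAcceptingRun I F T x q := fun x q hq => ⟨hq.init.1, hq.step, hq.acc⟩
  refine ⟨Q, hQ, {s ∈ I | ∃ p ∈ A.I, p ∉ o s}, F, T, fun x => ?_, fun x q q' hq hq' => ?_⟩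
  · obtain ⟨q, hq, ho, hu⟩ := h x
    rw [BuchiAutomaton.mem_language_iff, ← ho 0]
    constructor
    · exact fun hp => ⟨q, ⟨hq.init, hp⟩, hq.step, hq.acc⟩
    · rintro ⟨q', hq'⟩
      rw [← hu q' (hrun x q' hq')]
      exact hq'.init.2
  · obtain ⟨_, _, _, hu⟩ := h x
    exact (hu q (hrun x q hq)).trans (hu q' (hrun x q' hq')).symm

/-! ### Reindexing infinitary sums -/

namespace CompleteMonoid

variable {K : Type w} [AddMonoid K] (V : CompleteMonoid.{u, w} K)

/-- Partition `ι` into the fibres of `e`: each is a singleton or empty, and empty blocks contribute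
`0`. -/
theorem sum_eq_of_injective {ι κ : Type u} {e : ι → κ} (he : Function.Injective e) {k : κ → K}
    (hk : ∀ j, (∀ i, e i ≠ j) → k j = 0) : V.sum (fun i => k (e i)) = V.sum k := by
  rw [← V.sum_partition (κ := κ) (fun i => k (e i)) (fun j => {i | e i = j})
    (Set.eq_univ_of_forall fun i => Set.mem_iUnion.2 ⟨e i, rfl⟩)
    fun j j' hj => Set.disjoint_left.2 fun i hi hi' => hj (hi.symm.trans hi')]
  congr 1
  funext j
  by_cases h : ∃ i, e i = j
  · obtain ⟨i, rfl⟩ := h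
    exact V.sum_singleton (fun i' : {i' | e i' = e i} => k (e i')) ⟨i, rfl⟩
      fun i' => Subtype.ext (he i'.2)
  · rw [not_exists] at h
    rw [hk j h]
    exact V.sum_empty _ ⟨fun i => h i.1 i.2⟩

end CompleteMonoid

/-! ### The two directions of the decomposition -/

section Nivat

variable {S : Type u} {M : Type v} {K : Type w} [AddMonoid K]
  (V : ValuationStructure.{u, v, w} M K)

/-- A weighted automaton whose runs on `x` correspond, via an injective assignment of words that
preserves weights, to the words of `R` with image `x` computes the renaming of `R`. -/
theorem behavior_eq_renameLanguage {G : Type u} (A : WeightedBuchiAutomaton S M) {h : G → S}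
    {g : G → M} {R : Set (ℕ → G)} (e : (ℕ → A.T) → ℕ → G)
    (hw : ∀ ρ i, A.wt (ρ i) = g (e ρ i))
    (hmem : ∀ x, ∀ ρ ∈ A.runs x, e ρ ∈ R ∧ renameWord h (e ρ) = x)
    (hinj : ∀ x, Set.InjOn e (A.runs x))
    (hsurj : ∀ y ∈ R, ∃ ρ ∈ A.runs (renameWord h y), e ρ = y) :
    A.behavior V = renameLanguage V h (inter (valComp V g) R) := by
  funext x
  let e' : A.runs x → {y : ℕ → G // renameWord h y = x} := fun ρ => ⟨e ρ.1, (hmem x ρ.1 ρ.2).2⟩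
  have he' : Function.Injective e' := fun ρ ρ' hρ =>
    Subtype.ext (hinj x ρ.2 ρ'.2 (congrArg Subtype.val hρ))
  refine Eq.trans ?_ (V.sum_eq_of_injective he'
    (k := fun y => inter (valComp V g) R y.1) fun y hy => if_neg fun hR => ?_)
  · refine congrArg V.sum (funext fun ρ => ?_)
    refine Eq.trans ?_ (if_pos (hmem x ρ.1 ρ.2).1).symm
    exact congrArg V.val (funext fun i => hw ρ.1 i)
  · obtain ⟨y, rfl⟩ := y
    obtain ⟨ρ, hρ, rfl⟩ := hsurj y hR
    exact hy ⟨ρ, hρ⟩ rfl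

theorem recognizable_empty {G : Type u} : Recognizable (∅ : Set (ℕ → G)) := by
  refine ⟨⟨PUnit, inferInstance, ∅, ∅, ∅⟩, Set.eq_empty_of_forall_notMem ?_⟩
  rintro x ⟨ρ, ⟨q, -, h0, -⟩, -⟩
  exact h0

/-- The set of runs of a Büchi automaton is recognizable. -/
theorem recognizable_setOf_isRun (A : BuchiAutomaton S) : Recognizable {ρ | A.IsRun ρ} := by
  have := A.finite_states
  refine ⟨⟨A.Q, A.finite_states, A.I, {t | t.2.1.1 = (t.1, t.2.1.1.2.1, t.2.2)}, A.F⟩, ?_⟩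
  ext ρ
  constructor
  · rintro ⟨σ, ⟨q, hq, h0, hF⟩, rfl⟩
    refine ⟨q, fun i => ?_, h0, hF⟩
    have h := (σ i).2
    exact ⟨(congrArg Prod.fst h).trans (hq i).1, (congrArg (fun t => t.2.2) h).trans (hq i).2⟩
  · rintro ⟨q, hq, h0, hF⟩
    exact ⟨fun i => ⟨(q i, ρ i, q (i + 1)), Prod.ext (hq i).1 (Prod.ext rfl (hq i).2)⟩,
      ⟨q, fun i => ⟨rfl, rfl⟩, h0, hF⟩, rfl⟩

theorem exists_renaming_of_automaton [Finite S] [Nonempty S] (A : WeightedBuchiAutomaton S M) :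
    ∃ (G : Type u) (_ : Finite G) (_ : Nonempty G) (h : G → S) (g : G → M) (R : Set (ℕ → G)),
      Recognizable R ∧ (A.Unambiguous → HUnambiguous h R) ∧
        A.behavior V = renameLanguage V h (inter (valComp V g) R) := by
  have := A.finite_states
  have := V.nonempty_weights
  by_cases hT : Nonempty A.T
  · refine ⟨A.T, inferInstance, hT, fun t => t.1.2.1, A.wt, {ρ | A.IsRun ρ},
      recognizable_setOf_isRun _, fun hA x y hy y' hy' hx hx' => hA x ⟨hy, hx⟩ ⟨hy', hx'⟩,
      behavior_eq_renameLanguage V A id (fun _ _ => rfl) (fun x ρ hρ => hρ)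
        (fun _ => Set.injOn_id _) fun y hy => ⟨y, ⟨hy, rfl⟩, rfl⟩⟩
  -- An empty transition set is not an alphabet. There are no runs then, so one letter and the empty
  -- language serve.
  · refine ⟨PUnit, inferInstance, inferInstance, fun _ => Classical.arbitrary S,
      fun _ => Classical.arbitrary M, ∅, recognizable_empty, fun _ _ _ hy => hy.elim,
      behavior_eq_renameLanguage V A (fun _ _ => PUnit.unit) (fun ρ => (hT ⟨ρ 0⟩).elim)
        (fun _ ρ => (hT ⟨ρ 0⟩).elim) (fun _ ρ => (hT ⟨ρ 0⟩).elim) fun _ hy => hy.elim⟩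

/-- The letter of `G` about to be read is stored in the source state: transitions are mere triples,
and those for different letters with equal image under `h` must stay distinct and carry their own
weights. -/
theorem exists_automaton_of_renaming {G : Type u} [Finite G] (h : G → S) (g : G → M)
    {R : Set (ℕ → G)} (hR : Recognizable R) :
    ∃ A : WeightedBuchiAutomaton S M, (HUnambiguous h R → A.Unambiguous) ∧
      A.behavior V = renameLanguage V h (inter (valComp V g) R) := by
  obtain ⟨Q, _, I, F, T, hlang, huniq⟩ := hR.exists_unambiguous
  let A : WeightedBuchiAutomaton S M :=
    { Q := Q × G
      finite_states := inferInstance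
      I := {s | s.1 ∈ I}
      T := {t | T t.1.1 t.1.2 t.2.2.1 ∧ t.2.1 = h t.1.2}
      F := {s | s.1 ∈ F}
      wt := fun t => g t.1.1.2 }
  have : Finite A.Q := A.finite_states
  let e : (ℕ → A.T) → ℕ → G := fun ρ i => (A.states ρ i).2
  have hacc : ∀ x, ∀ ρ ∈ A.runs x, IsAcceptingRun I F T (e ρ) (fun i => (A.states ρ i).1) ∧
      renameWord h (e ρ) = x := by
    intro x ρ hρ
    have hs := BuchiAutomaton.isAcceptingRun_states hρ
    exact ⟨⟨hs.init, fun i => (hs.step i).1, hs.acc⟩, funext fun i => (hs.step i).2.symm⟩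
  have hmem : ∀ x, ∀ ρ ∈ A.runs x, e ρ ∈ R ∧ renameWord h (e ρ) = x :=
    fun x ρ hρ => ⟨(hlang _).2 ⟨_, (hacc x ρ hρ).1⟩, (hacc x ρ hρ).2⟩
  have hinj : ∀ x, Set.InjOn e (A.runs x) := by
    intro x ρ hρ ρ' hρ' he
    refine BuchiAutomaton.eq_of_states_eq hρ hρ' (funext fun i => Prod.ext ?_ (congrFun he i))
    have h1 := (hacc x ρ hρ).1
    rw [he] at h1
    exact congrFun (huniq _ _ _ h1 (hacc x ρ' hρ').1) i
  refine ⟨A, fun hu x ρ hρ ρ' hρ' => hinj x hρ hρ' ?_,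
    behavior_eq_renameLanguage V A e (fun _ _ => rfl) hmem hinj fun y hy => ?_⟩
  · exact hu x _ (hmem x ρ hρ).1 _ (hmem x ρ' hρ').1 (hmem x ρ hρ).2 (hmem x ρ' hρ').2
  · obtain ⟨q, hq⟩ := (hlang y).1 hy
    obtain ⟨ρ, hρ, hs⟩ := BuchiAutomaton.exists_run_of_isAcceptingRun (A := A.toBuchiAutomaton)
      (x := renameWord h y) (q := fun i => (q i, y i))
      ⟨hq.init, fun i => ⟨hq.step i, rfl⟩, hq.acc⟩
    exact ⟨ρ, hρ, funext fun i => congrArg Prod.snd (congrFun hs i)⟩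

end Nivat

end WBA

theorem theorem3p1 {S : Type u} [Finite S] [Nonempty S] {M : Type v} {K : Type w} [AddMonoid K]
    (V : WBA.ValuationStructure.{u, v, w} M K) (L : (ℕ → S) → K) :
    (WBA.UnambiguouslyQRecognizable V L ↔
      ∃ (G : Type u) (_ : Finite G) (_ : Nonempty G) (h : G → S) (g : G → M)
        (R : Set (ℕ → G)), WBA.Recognizable R ∧ WBA.HUnambiguous h R ∧
          L = WBA.renameLanguage V h (WBA.inter (WBA.valComp V g) R)) ∧
    (WBA.QRecognizable V L ↔
      ∃ (G : Type u) (_ : Finite G) (_ : Nonempty G) (h : G → S) (g : G → M)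
        (R : Set (ℕ → G)), WBA.Recognizable R ∧
          L = WBA.renameLanguage V h (WBA.inter (WBA.valComp V g) R)) := by
  refine ⟨⟨?_, ?_⟩, ?_, ?_⟩
  · rintro ⟨A, hA, rfl⟩
    obtain ⟨G, hG, hG', h, g, R, hR, hu, hL⟩ := WBA.exists_renaming_of_automaton V A
    exact ⟨G, hG, hG', h, g, R, hR, hu hA, hL⟩
  · rintro ⟨G, _, _, h, g, R, hR, hu, rfl⟩
    obtain ⟨A, hA, hL⟩ := WBA.exists_automaton_of_renaming V h g hR
    exact ⟨A, hA hu, hL⟩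
  · rintro ⟨A, rfl⟩
    obtain ⟨G, hG, hG', h, g, R, hR, -, hL⟩ := WBA.exists_renaming_of_automaton V A
    exact ⟨G, hG, hG', h, g, R, hR, hL⟩
  · rintro ⟨G, _, _, h, g, R, hR, rfl⟩
    obtain ⟨A, -, hL⟩ := WBA.exists_automaton_of_renaming V h g hR
    exact ⟨A, hL⟩
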